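/- Let $(X,\mathcal F,\mu)$ be a probability space and let $T:X\to X$ be an ergodic measure-preserving transformation. Let $(f_n)_{n\ge 1}$ be measurable functions $f_n:X\to[0,\infty)$ such that $\sup_{x\in X}f_1(x)<\infty$ and $$f_{n+m}(x)\le f_m(x)\,f_n(T^m x)\qquad\text{for all integers } m,n\ge 1 \text{ and all } x\in X.$$ Put $\log 0=-\infty$. Then for every $n\geq 1$ the positive part of $\log f_n$ has finite integral, so that $\int\log f_n\,d\mu\in[-\infty,\infty)$ is well defined, and the limit $$\alpha=\lim_{n\to\infty}\frac1n\int\log f_n\,d\mu$$ exists in $[-\infty,\infty)$. Moreover, for every $\epsilon>0$: (i) If $\alpha\neq-\infty$, then for $\mu$-almost every $x\in X$ there exists a positive integer $n_0(x)$ such that $$|\log f_n(T^m x)-n\alpha|\le (n+m)\epsilon\qquad\text{for all integers } n\ge n_0(x) \text{ and } m\ge 0.$$ (ii) If $\alpha=-\infty$, then for every real $N>0$ and for $\mu$-almost every $x\in X$ there exists a positive integer $n_0(x)$ such that $$\log f_n(T^m x)\le -Nn+(n+m)\epsilon\qquad\text{for all integers } n\ge n_0(x)\text{ and } m\ge 0.$$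 -/

import Mathlib

open MeasureTheory Filter Topology
open scoped ENNReal

/-- The extended logarithm of a non-negative real number, with the convention `log 0 = -∞`
(for `t > 0` it is the usual `Real.log t`). -/
noncomputable def extLog (t : ℝ) : EReal :=
  ENNReal.log (ENNReal.ofReal t)

/-- The integral `∫ g⁺ dμ - ∫ g⁻ dμ` of an extended-real function, with values in `[-∞, ∞]`.
It is the usual (quasi-)integral as soon as one of the two parts has finite integral;
`EReal.toENNReal` is the positive part, i.e. `max · 0` as an element of `[0, ∞]`. -/
noncomputable def extIntegral {X : Type*} [MeasurableSpace X] (μ : Measure X) (g : X → EReal) :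
    EReal :=
  ((∫⁻ x, (g x).toENNReal ∂μ : ℝ≥0∞) : EReal) - ((∫⁻ x, (-(g x)).toENNReal ∂μ : ℝ≥0∞) : EReal)

/-!
Since `f 1` is bounded by some `exp C` with `C ≥ 0`, each `log (f n)` is at most `n * C`, and
`g n = n * C - log (f n)` takes values in `[0, ∞]` and is superadditive along orbits:
`g m x + g n (T^[m] x) ≤ g (m + n) x`. With `γ = sup (1 / n) ∫ g n` (`growthRate`) the limit `α` is
`C - γ`, so that everything reduces to Kingman's theorem for nonnegative superadditive cocycles,
where all integrals live in `[0, ∞]`.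

Upper bound (`ae_eventually_le_mul`): the set where `g n` exceeds `c * n` infinitely often, up to a
constant, contains its preimage under `T`, hence is null or conull. If it were conull for some
`c > γ`, cutting long orbit segments into blocks on which `g` has slope at least `c' ∈ (γ, c)`
(`mul_birkhoffSum_indicator_le`) would give `∫ g K` of order at least `c' * K`, contradicting
`∫ g K ≤ K * γ`. Applied to the Birkhoff sums of `h` and of `M - h`, the same statement yields
Birkhoff's theorem for bounded functions (`ae_abs_birkhoffSum_sub_le`).

Lower bound (`ae_exists_ofReal_le`): `g n` dominates, up to a bounded error, the Birkhoff sums of a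
truncation of `g N / N`. A Birkhoff sum started at `T^[m] x` is the difference of two started at
`x`, so the bound holds for all starting times `m` with an error `(n + m) * ε`.

The upper bound at `T^[m] x` then comes from `g n (T^[m] x) ≤ g (m + n) x - g m x`
(`ae_exists_abs_sub_le`). When `γ = ∞` only the lower bound for `g` is needed.
-/

/-! ### Upper bound for superadditive cocycles -/

/-- Covering estimate. Along an orbit segment of length `K`, jump `n ≤ L` steps from a point of `E`
at which `c * n ≤ g n`, and one step from any other point: the jumped blocks cover every visit to
`E` except perhaps among the last `L` times, and superadditivity adds up the gains of the blocks. -/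
theorem mul_birkhoffSum_indicator_le {X : Type*} (T : X → X) {g : ℕ → X → ℝ≥0∞}
    (hg : ∀ m n x, g m x + g n (T^[m] x) ≤ g (m + n) x) {E : Set X} {c : ℝ≥0∞} {L : ℕ}
    (hE : ∀ x ∈ E, ∃ n, 1 ≤ n ∧ n ≤ L ∧ c * n ≤ g n x) (K : ℕ) (x : X) :
    c * birkhoffSum T (E.indicator 1) K x ≤ g K x + c * L := by
  have hcard : ∀ (K : ℕ) (x : X), birkhoffSum T (E.indicator (1 : X → ℝ≥0∞)) K x ≤ K := by
    intro K x
    calc birkhoffSum T (E.indicator (1 : X → ℝ≥0∞)) K x ≤ ∑ i ∈ Finset.range K, 1 :=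
          Finset.sum_le_sum fun i _ => Set.indicator_le_self' (by simp) _
      _ = K := by simp
  induction K using Nat.strong_induction_on generalizing x with
  | _ K ih =>
  by_cases hK : K ≤ L
  · calc c * birkhoffSum T (E.indicator 1) K x ≤ c * L := by
          gcongr
          exact (hcard K x).trans (by exact_mod_cast hK)
      _ ≤ _ := le_add_self
  · push Not at hK
    by_cases hx : x ∈ E
    · obtain ⟨n, h1, hnL, hn⟩ := hE x hx
      obtain ⟨k, rfl⟩ : ∃ k, K = n + k := ⟨K - n, by omega⟩
      calc c * birkhoffSum T (E.indicator 1) (n + k) x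
          = c * birkhoffSum T (E.indicator 1) n x
            + c * birkhoffSum T (E.indicator 1) k (T^[n] x) := by
            rw [birkhoffSum_add, mul_add]
        _ ≤ g n x + (g k (T^[n] x) + c * L) := by
            gcongr
            · exact (mul_le_mul_right (hcard n x) c).trans hn
            · exact ih k (by omega) _
        _ = (g n x + g k (T^[n] x)) + c * L := by ring
        _ ≤ _ := by
            gcongr
            exact hg n k x
    · obtain ⟨k, rfl⟩ : ∃ k, K = k + 1 := ⟨K - 1, by omega⟩
      calc c * birkhoffSum T (E.indicator 1) (k + 1) x
          = c * birkhoffSum T (E.indicator 1) k (T x) := by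
            rw [birkhoffSum_succ']; simp [hx]
        _ ≤ g k (T x) + c * L := ih k (by omega) _
        _ ≤ _ := by
            gcongr
            have := hg 1 k x
            rw [add_comm 1 k] at this
            exact le_add_self.trans this

theorem lintegral_birkhoffSum {X : Type*} [MeasurableSpace X] {μ : Measure X} {T : X → X}
    (hT : MeasurePreserving T μ μ) {h : X → ℝ≥0∞} (hh : Measurable h) (n : ℕ) :
    ∫⁻ x, birkhoffSum T h n x ∂μ = n * ∫⁻ x, h x ∂μ := by
  simp only [birkhoffSum]
  rw [lintegral_finsetSum (f := fun i x => h (T^[i] x)) _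
    fun i _ => hh.comp (hT.iterate i).measurable]
  simp [(hT.iterate _).lintegral_comp hh]

/-- If almost every point has some time `n` at which `g n` reaches the slope `c`, then `c` is at most
the mean growth rate: integrate the covering estimate over the sets where `n ≤ L` suffices, divide
by the length of the segment, and let `L → ∞`. -/
theorem le_of_ae_exists_mul_le {X : Type*} [MeasurableSpace X] {μ : Measure X}
    [IsProbabilityMeasure μ] {T : X → X} (hT : MeasurePreserving T μ μ) {g : ℕ → X → ℝ≥0∞}
    (hmeas : ∀ n, Measurable (g n)) (hg : ∀ m n x, g m x + g n (T^[m] x) ≤ g (m + n) x)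
    {γ c : ℝ≥0∞} (hc : c ≠ ∞) (hγ : ∀ n, ∫⁻ x, g n x ∂μ ≤ n * γ)
    (h : ∀ᵐ x ∂μ, ∃ n, 1 ≤ n ∧ c * n ≤ g n x) : c ≤ γ := by
  let E : ℕ → Set X := fun L => {x | ∃ n, 1 ≤ n ∧ n ≤ L ∧ c * n ≤ g n x}
  have hEm : ∀ L, MeasurableSet (E L) := by
    intro L
    have : E L = ⋃ n, ⋃ (_ : 1 ≤ n ∧ n ≤ L), {x | c * n ≤ g n x} := by
      ext x; simp [E, and_assoc]
    rw [this]
    exact .iUnion fun n => .iUnion fun _ => measurableSet_le measurable_const (hmeas n)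
  have hE1 : Tendsto (fun L => c * μ (E L)) atTop (𝓝 (c * 1)) := by
    refine ENNReal.Tendsto.const_mul ?_ (.inr hc)
    have hmono : Monotone E := fun a b hab x ⟨n, h1, h2, h3⟩ => ⟨n, h1, h2.trans hab, h3⟩
    have := tendsto_measure_iUnion_atTop (μ := μ) hmono
    rwa [(prob_compl_eq_zero_iff (MeasurableSet.iUnion hEm)).1 ?_] at this
    refine measure_mono_null ?_ (ae_iff.1 h)
    intro x hx hx'
    obtain ⟨n, h1, h2⟩ := hx'
    exact hx (Set.mem_iUnion.2 ⟨n, n, h1, le_rfl, h2⟩)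
  rw [mul_one] at hE1
  refine le_of_tendsto' hE1 fun L => ?_
  have key : ∀ K : ℕ, 1 ≤ K → c * μ (E L) ≤ γ + c * L / K := by
    intro K hK
    have hK0 : (K : ℝ≥0∞) ≠ 0 := by positivity
    have hmE : Measurable ((E L).indicator (1 : X → ℝ≥0∞)) := measurable_one.indicator (hEm L)
    have h1 : c * (K * μ (E L)) ≤ K * γ + c * L := by
      calc c * (K * μ (E L))
          = ∫⁻ x, c * birkhoffSum T ((E L).indicator 1) K x ∂μ := by
            rw [lintegral_const_mul' _ _ hc, lintegral_birkhoffSum hT hmE,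
              lintegral_indicator_one (hEm L)]
        _ ≤ ∫⁻ x, (g K x + c * L) ∂μ :=
            lintegral_mono fun x => mul_birkhoffSum_indicator_le T hg (fun x hx => hx) K x
        _ ≤ _ := by
            rw [lintegral_add_right _ measurable_const]
            simpa using add_le_add_left (hγ K) (c * L)
    have h2 : c * (K * μ (E L)) = (c * μ (E L)) * K := by ring
    have h3 : γ + c * L / K = (K * γ + c * L) / K := by
      rw [ENNReal.add_div, mul_comm _ γ, ENNReal.mul_div_cancel_right hK0 (by simp)]
    rw [h3, ENNReal.le_div_iff_mul_le (.inl hK0) (.inl (by simp)), ← h2]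
    exact h1
  have hlim : Tendsto (fun K : ℕ => γ + c * L / K) atTop (𝓝 (γ + 0)) := by
    refine tendsto_const_nhds.add ?_
    have hcL : c * L ≠ ∞ := ENNReal.mul_ne_top hc (by simp)
    simpa [div_eq_mul_inv] using
      ENNReal.Tendsto.const_mul ENNReal.tendsto_inv_nat_nhds_zero (.inr hcL)
  rw [add_zero] at hlim
  exact ge_of_tendsto hlim (eventually_atTop.2 ⟨1, key⟩)

/-- Upper half of Kingman's theorem for a nonnegative superadditive cocycle over an ergodic map:
the pointwise growth rate does not exceed the mean one. -/
theorem ae_eventually_le_mul {X : Type*} [MeasurableSpace X] {μ : Measure X}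
    [IsProbabilityMeasure μ] {T : X → X} (hT : Ergodic T μ) {g : ℕ → X → ℝ≥0∞}
    (hmeas : ∀ n, Measurable (g n)) (hg : ∀ m n x, g m x + g n (T^[m] x) ≤ g (m + n) x)
    {γ c : ℝ≥0∞} (hc : c ≠ ∞) (hγ : ∀ n, ∫⁻ x, g n x ∂μ ≤ n * γ) (hγc : γ < c) :
    ∀ᵐ x ∂μ, ∀ᶠ n : ℕ in atTop, g n x ≤ c * n := by
  -- the additive slack `k` makes `A` contain its preimage: passing from `T x` to `x` costs `c`
  let A : Set X := {x | ∃ k : ℕ, ∃ᶠ n : ℕ in atTop, c * n ≤ g n x + k}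
  have hA : MeasurableSet A := by
    have : A = ⋃ k : ℕ, ⋂ a : ℕ, ⋃ b : ℕ, ⋃ (_ : a ≤ b), {x | c * b ≤ g b x + k} := by
      ext x; simp [A, frequently_atTop]
    rw [this]
    exact .iUnion fun k => .iInter fun a => .iUnion fun b => .iUnion fun _ =>
      measurableSet_le measurable_const ((hmeas b).add_const _)
  have hTA : T ⁻¹' A ⊆ A := by
    rintro x ⟨k, hk⟩
    obtain ⟨j, hj⟩ := ENNReal.exists_nat_gt hc
    refine ⟨k + j, ?_⟩
    rw [frequently_atTop] at hk ⊢
    intro a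
    obtain ⟨b, hab, hb⟩ := hk a
    refine ⟨b + 1, by omega, ?_⟩
    have h1 := hg 1 b x
    rw [add_comm 1 b] at h1
    calc c * ((b + 1 : ℕ) : ℝ≥0∞) = c * b + c := by push_cast; ring
      _ ≤ (g b (T x) + k) + j := by gcongr
      _ ≤ (g (b + 1) x + k) + j := by
          gcongr
          exact le_add_self.trans h1
      _ = _ := by push_cast; ring
  rcases hT.ae_empty_or_univ_of_preimage_ae_le hA.nullMeasurableSet
      (Eventually.of_forall hTA) with h | h
  · have := measure_eq_zero_iff_ae_notMem.1 (ae_eq_empty.1 h)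
    filter_upwards [this] with x hx
    by_contra hcon
    refine hx ⟨0, ?_⟩
    refine (not_eventually.1 hcon).mono fun n hn => ?_
    simpa using (not_le.1 hn).le
  · exfalso
    obtain ⟨d, hd1, hd2⟩ := exists_between hγc
    have hdtop : d ≠ ∞ := hd2.ne_top
    refine absurd (le_of_ae_exists_mul_le hT.toMeasurePreserving hmeas hg hdtop hγ ?_)
      (not_le.2 hd1)
    have hu : ∀ᵐ x ∂μ, x ∈ A := by simpa using eventuallyEq_univ.1 h
    filter_upwards [hu] with x hx
    obtain ⟨k, hk⟩ := hx
    -- the slack `k` is absorbed by `(c - d) * n` once `n` is large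
    obtain ⟨p, hp⟩ := ENNReal.exists_nat_mul_gt (a := c - d) (b := k)
      (tsub_pos_of_lt hd2).ne' (by simp)
    rw [frequently_atTop] at hk
    obtain ⟨n, hn, hn'⟩ := hk (p + 1)
    refine ⟨n, by omega, ?_⟩
    have h2 : (k : ℝ≥0∞) ≤ (c - d) * n := by
      rw [mul_comm]
      refine hp.le.trans ?_
      gcongr
      omega
    have h3 : d * n + k ≤ g n x + k := by
      calc d * n + k ≤ d * n + (c - d) * n := by gcongr
        _ = c * n := by rw [← add_mul, add_tsub_cancel_of_le hd2.le]
        _ ≤ _ := hn'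
    exact (ENNReal.add_le_add_iff_right (by simp)).1 h3

/-! ### Birkhoff's theorem for bounded functions -/

/-- Upper half of Birkhoff's theorem, for a nonnegative function: its Birkhoff sums are a
superadditive (indeed additive) cocycle. -/
theorem ae_eventually_birkhoffSum_le {X : Type*} [MeasurableSpace X] {μ : Measure X}
    [IsProbabilityMeasure μ] {T : X → X} (hT : Ergodic T μ) {h : X → ℝ} (hh : Integrable h μ)
    (hm : Measurable h) (h0 : ∀ x, 0 ≤ h x) {δ : ℝ} (hδ : 0 < δ) :
    ∀ᵐ x ∂μ, ∀ᶠ n : ℕ in atTop, birkhoffSum T h n x ≤ n * (∫ x, h x ∂μ + δ) := by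
  have hI : 0 ≤ ∫ x, h x ∂μ := integral_nonneg h0
  have hm' : Measurable fun x => ENNReal.ofReal (h x) := hm.ennreal_ofReal
  have := ae_eventually_le_mul hT (g := fun n => birkhoffSum T (fun x => ENNReal.ofReal (h x)) n)
    (γ := ENNReal.ofReal (∫ x, h x ∂μ)) (c := ENNReal.ofReal (∫ x, h x ∂μ + δ))
    (fun n => Finset.measurable_fun_sum _ fun i _ => hm'.comp (hT.iterate i).measurable)
    (fun m n x => (birkhoffSum_add ..).ge) (by simp)
    (fun n => by
      rw [lintegral_birkhoffSum hT.toMeasurePreserving hm',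
        ofReal_integral_eq_lintegral_ofReal hh (Eventually.of_forall h0)])
    ((ENNReal.ofReal_lt_ofReal_iff (by positivity)).2 (by linarith))
  filter_upwards [this] with x hx
  filter_upwards [hx] with n hn
  rw [birkhoffSum, ← ENNReal.ofReal_sum_of_nonneg (fun _ _ => h0 _), ← ENNReal.ofReal_natCast,
    ← ENNReal.ofReal_mul (by positivity), ENNReal.ofReal_le_ofReal_iff (by positivity)] at hn
  rw [mul_comm]
  exact hn

/-- Birkhoff's theorem for a bounded function `h`, with an error bound valid at all times. The lower
bound is the upper bound for `M - h`. -/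
theorem ae_abs_birkhoffSum_sub_le {X : Type*} [MeasurableSpace X] {μ : Measure X}
    [IsProbabilityMeasure μ] {T : X → X} (hT : Ergodic T μ) {h : X → ℝ} (hm : Measurable h)
    {M : ℝ} (h0 : ∀ x, 0 ≤ h x) (hM : ∀ x, h x ≤ M) {δ : ℝ} (hδ : 0 < δ) :
    ∀ᵐ x ∂μ, ∃ D : ℝ, ∀ n : ℕ, |birkhoffSum T h n x - n * ∫ x, h x ∂μ| ≤ n * δ + D := by
  have hint : Integrable h μ := .of_bound hm.aestronglyMeasurable M
    (Eventually.of_forall fun x => by rw [Real.norm_of_nonneg (h0 x)]; exact hM x)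
  have hint' : Integrable (fun x => M - h x) μ := (integrable_const M).sub hint
  have hI0 : 0 ≤ ∫ x, h x ∂μ := integral_nonneg h0
  have hIM : ∫ x, h x ∂μ ≤ M := by
    simpa using integral_mono hint (integrable_const M) hM
  filter_upwards [ae_eventually_birkhoffSum_le hT hint hm h0 hδ,
    ae_eventually_birkhoffSum_le hT hint' (measurable_const.sub hm)
      (fun x => sub_nonneg.2 (hM x)) hδ] with x h1 h2
  obtain ⟨K, hK⟩ := eventually_atTop.1 (h1.and h2)
  have hM0 : 0 ≤ M := hI0.trans hIM
  refine ⟨K * M, fun n => ?_⟩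
  rw [abs_le]
  rcases le_total K n with hn | hn
  · obtain ⟨ha, hb⟩ := hK n hn
    have hs : birkhoffSum T (fun x => M - h x) n x = n * M - birkhoffSum T h n x := by
      simp [birkhoffSum, Finset.sum_sub_distrib]
    rw [hs, integral_sub (integrable_const M) hint] at hb
    simp only [integral_const, probReal_univ, smul_eq_mul, one_mul] at hb
    have : 0 ≤ K * M := by positivity
    constructor <;> linarith
  · have hs0 : 0 ≤ birkhoffSum T h n x := Finset.sum_nonneg fun i _ => h0 _
    have hsM : birkhoffSum T h n x ≤ n * M := by
      calc birkhoffSum T h n x ≤ ∑ i ∈ Finset.range n, M := Finset.sum_le_sum fun i _ => hM _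
        _ = n * M := by simp
    have hnI : n * ∫ x, h x ∂μ ≤ n * M := by gcongr
    have hnI0 : 0 ≤ n * ∫ x, h x ∂μ := by positivity
    have hnK : (n : ℝ) * M ≤ K * M := by gcongr
    have : 0 ≤ n * δ := by positivity
    constructor <;> linarith

/-! ### Lower bound for superadditive cocycles -/

/-- A superadditive cocycle dominates the average over the `N + 1` shifts of its splittings into
blocks of length `N + 1`. For the sum `G k x` of `g (k + N - r) (T^[r] x)` over
`r ≤ N`, superadditivity gives `g (N + 1) x + G k (T x) ≤ G (k + 1) x`. -/
theorem birkhoffSum_le_mul {X : Type*} (T : X → X) {g : ℕ → X → ℝ≥0∞}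
    (hg : ∀ m n x, g m x + g n (T^[m] x) ≤ g (m + n) x) (N k : ℕ) (x : X) :
    birkhoffSum T (g (N + 1)) k x ≤ (N + 1 : ℕ) * g (k + N) x := by
  have key : ∀ (k : ℕ) (x : X), birkhoffSum T (g (N + 1)) k x
      ≤ ∑ r ∈ Finset.range (N + 1), g (k + N - r) (T^[r] x) := by
    intro k
    induction k with
    | zero => simp
    | succ k ih =>
      intro x
      have h1 : g (N + 1) x + g k (T^[N] (T x)) ≤ g (k + 1 + N) x := by
        have := hg (N + 1) k x
        rwa [show N + 1 + k = k + 1 + N by omega] at this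
      rw [birkhoffSum_succ', Finset.sum_range_succ']
      calc g (N + 1) x + birkhoffSum T (g (N + 1)) k (T x)
          ≤ g (N + 1) x + ∑ r ∈ Finset.range (N + 1), g (k + N - r) (T^[r] (T x)) := by
            gcongr
            exact ih _
        _ = ∑ r ∈ Finset.range N, g (k + N - r) (T^[r] (T x))
            + (g (N + 1) x + g k (T^[N] (T x))) := by
            rw [Finset.sum_range_succ, Nat.add_sub_cancel]
            ring
        _ ≤ _ := by
            gcongr with r hr
            · rw [show k + 1 + N - (r + 1) = k + N - r by omega]
              rfl
            · simpa using h1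
  refine (key k x).trans ?_
  calc ∑ r ∈ Finset.range (N + 1), g (k + N - r) (T^[r] x)
      ≤ ∑ r ∈ Finset.range (N + 1), g (k + N) x := by
        refine Finset.sum_le_sum fun r hr => ?_
        have hr' : r ≤ k + N := by have := Finset.mem_range.1 hr; omega
        have := hg r (k + N - r) x
        rw [Nat.add_sub_cancel' hr'] at this
        exact le_add_self.trans this
    _ = _ := by simp

/-- Lower bound for `g` along whole orbits, uniform in the starting time `m`. The Birkhoff sum of
length `k` from `T^[m] x` is the difference of those of lengths `m + k` and `m` from `x`, which is
why the error is linear in `n + m`. Truncating `g (N + 1)` leaves room for an infinite integral. -/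
theorem ae_exists_ofReal_le {X : Type*} [MeasurableSpace X] {μ : Measure X}
    [IsProbabilityMeasure μ] {T : X → X} (hT : Ergodic T μ) {g : ℕ → X → ℝ≥0∞}
    (hmeas : ∀ n, Measurable (g n)) (hg : ∀ m n x, g m x + g n (T^[m] x) ≤ g (m + n) x)
    {a : ℝ} {N : ℕ} (ha : ENNReal.ofReal ((N + 1) * a) < ∫⁻ x, g (N + 1) x ∂μ)
    {ε : ℝ} (hε : 0 < ε) :
    ∀ᵐ x ∂μ, ∃ D : ℝ, ∀ n m : ℕ,
      ENNReal.ofReal (n * a - (n + m) * ε - D) ≤ g n (T^[m] x) := by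
  -- truncate `g (N + 1)` at a height that keeps its integral above `(N + 1) * a`
  obtain ⟨M, hM⟩ : ∃ M : ℕ, ENNReal.ofReal ((N + 1) * a) < ∫⁻ x, min (g (N + 1) x) M ∂μ := by
    have h1 : ∀ x, g (N + 1) x = ⨆ M : ℕ, min (g (N + 1) x) M := by
      intro x
      rw [← inf_iSup_eq, ENNReal.iSup_natCast, inf_top_eq]
    rw [lintegral_congr h1, lintegral_iSup (fun M => (hmeas _).min measurable_const)
      (fun i j hij x => min_le_min_left _ (by exact_mod_cast hij))] at ha
    exact lt_iSup_iff.1 ha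
  set h : X → ℝ := fun x => (min (g (N + 1) x) M).toReal
  have htop : ∀ x, min (g (N + 1) x) (M : ℝ≥0∞) ≠ ∞ := fun x =>
    ((min_le_right _ _).trans_lt (by simp)).ne
  have hm : Measurable h := ((hmeas _).min measurable_const).ennreal_toReal
  have hI : (N + 1) * a ≤ ∫ x, h x ∂μ := by
    rw [integral_toReal ((hmeas _).min measurable_const).aemeasurable
      (Eventually.of_forall fun x => (htop x).lt_top)]
    refine (ENNReal.ofReal_le_iff_le_toReal ?_).1 hM.le
    have : ∫⁻ x, min (g (N + 1) x) M ∂μ ≤ ∫⁻ _, M ∂μ := lintegral_mono fun x => min_le_right _ _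
    exact (this.trans_lt (by simp)).ne
  -- two Birkhoff sums are compared, and the result is divided by `N + 1`
  have hδ : 0 < ε * (N + 1) / 2 := by positivity
  filter_upwards [ae_abs_birkhoffSum_sub_le hT hm (M := M) (fun x => ENNReal.toReal_nonneg)
    (fun x => by simpa using ENNReal.toReal_mono (by simp) (min_le_right (g (N + 1) x) (M : ℝ≥0∞)))
    hδ] with x hx
  obtain ⟨D, hD⟩ := hx
  have hD0 : 0 ≤ D := by simpa using hD 0
  refine ⟨N * |a| + 2 * D / (N + 1), fun n m => ?_⟩
  have haa : a ≤ |a| := le_abs_self a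
  have hdD : 0 ≤ 2 * D / (N + 1 : ℝ) := by positivity
  have hnm : 0 ≤ (n + m) * ε := by positivity
  -- for `n < N` no full block fits, and the constant makes the bound nonpositive
  rcases lt_or_ge n N with hn | hn
  · rw [ENNReal.ofReal_of_nonpos]
    · exact zero_le
    · have h1 : (n : ℝ) * a ≤ N * |a| :=
        (mul_le_mul_of_nonneg_left haa (by positivity)).trans (by gcongr)
      linarith
  · obtain ⟨k, rfl⟩ : ∃ k, n = k + N := ⟨n - N, by omega⟩
    have h1 : ENNReal.ofReal (birkhoffSum T h k (T^[m] x))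
        ≤ (N + 1 : ℕ) * g (k + N) (T^[m] x) := by
      refine le_trans ?_ (birkhoffSum_le_mul T hg N k (T^[m] x))
      rw [birkhoffSum, ENNReal.ofReal_sum_of_nonneg fun _ _ => ENNReal.toReal_nonneg]
      refine Finset.sum_le_sum fun i _ => ?_
      rw [ENNReal.ofReal_toReal (htop _)]
      exact min_le_left _ _
    have h2 : birkhoffSum T h (m + k) x = birkhoffSum T h m x + birkhoffSum T h k (T^[m] x) :=
      birkhoffSum_add ..
    have h3 := abs_le.1 (hD (m + k))
    have h4 := abs_le.1 (hD m)
    have h5 : k * ((N + 1) * a) ≤ k * ∫ x, h x ∂μ := by gcongr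
    have h6 : (N + 1) * ((k + N : ℕ) * a - ((k + N : ℕ) + m) * ε - (N * |a| + 2 * D / (N + 1)))
        ≤ birkhoffSum T h k (T^[m] x) := by
      have e1 : (N + 1 : ℝ) * (2 * D / (N + 1)) = 2 * D := by field_simp
      have e2 : (N + 1 : ℝ) * (N * a) ≤ (N + 1 : ℝ) * (N * |a|) := by gcongr
      have e3 : 0 ≤ (N + 1 : ℝ) * ((N + k / 2) * ε) := by positivity
      push_cast at h3 ⊢
      linarith
    have h7 : ENNReal.ofReal ((N + 1) *
        ((k + N : ℕ) * a - ((k + N : ℕ) + m) * ε - (N * |a| + 2 * D / (N + 1))))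
        ≤ (N + 1 : ℕ) * g (k + N) (T^[m] x) := (ENNReal.ofReal_le_ofReal h6).trans h1
    rw [ENNReal.ofReal_mul (by positivity)] at h7
    have h8 : ENNReal.ofReal (N + 1) = ((N + 1 : ℕ) : ℝ≥0∞) := by
      rw [← ENNReal.ofReal_natCast]; push_cast; rfl
    rw [h8] at h7
    exact (ENNReal.mul_le_mul_iff_right (by positivity) (by simp)).1 h7

/-! ### Mean and pointwise growth rates -/

/-- The mean growth rate `sup_{n ≥ 1} (1 / n) ∫ g n ∂μ ∈ [0, ∞]` of a sequence of functions. The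
supremum runs over `n + 1` with `n : ℕ`, so that the index `0` is left out. -/
noncomputable def growthRate {X : Type*} [MeasurableSpace X] (μ : Measure X) (g : ℕ → X → ℝ≥0∞) :
    ℝ≥0∞ :=
  ⨆ n : ℕ, (∫⁻ x, g (n + 1) x ∂μ) / (n + 1 : ℕ)

theorem lintegral_le_mul_growthRate {X : Type*} [MeasurableSpace X] {μ : Measure X}
    {g : ℕ → X → ℝ≥0∞} (h0 : g 0 = 0) (n : ℕ) : ∫⁻ x, g n x ∂μ ≤ n * growthRate μ g := by
  cases n with
  | zero => simp [h0]
  | succ n =>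
    rw [mul_comm, ← ENNReal.div_le_iff_le_mul (.inl (by positivity)) (.inl (by simp))]
    exact le_iSup (fun n : ℕ => (∫⁻ x, g (n + 1) x ∂μ) / (n + 1 : ℕ)) n

/-- Fekete's lemma for the integrals, obtained by integrating `birkhoffSum_le_mul`; infinite values
are allowed. -/
theorem tendsto_lintegral_div {X : Type*} [MeasurableSpace X] {μ : Measure X}
    {T : X → X} (hT : MeasurePreserving T μ μ) {g : ℕ → X → ℝ≥0∞}
    (hmeas : ∀ n, Measurable (g n)) (h0 : g 0 = 0)
    (hg : ∀ m n x, g m x + g n (T^[m] x) ≤ g (m + n) x) :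
    Tendsto (fun n : ℕ => (∫⁻ x, g n x ∂μ) / n) atTop (𝓝 (growthRate μ g)) := by
  refine tendsto_order.2 ⟨fun b hb => ?_, fun b hb => ?_⟩
  · obtain ⟨N, hN⟩ := lt_iSup_iff.1 hb
    set A := (∫⁻ x, g (N + 1) x ∂μ) / (N + 1 : ℕ) with hA
    have h1 : ∀ k : ℕ, (k : ℝ≥0∞) * A ≤ ∫⁻ x, g (k + N) x ∂μ := by
      intro k
      have := lintegral_mono (μ := μ) fun x => birkhoffSum_le_mul T hg N k x
      rw [lintegral_birkhoffSum hT (hmeas _), lintegral_const_mul _ (hmeas _)] at this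
      rw [hA, ← mul_div_assoc]
      refine ENNReal.div_le_of_le_mul ?_
      rwa [mul_comm (∫⁻ x, g (k + N) x ∂μ)]
    have h2 : Tendsto (fun k : ℕ => ENNReal.ofReal ((k : ℝ) / (k + N)) * A) atTop (𝓝 (1 * A)) := by
      refine ENNReal.Tendsto.mul_const ?_ (.inl one_ne_zero)
      have := ENNReal.tendsto_ofReal (tendsto_natCast_div_add_atTop (N : ℝ))
      simpa using this
    rw [one_mul] at h2
    have h3 : ∀ᶠ k : ℕ in atTop, b < (∫⁻ x, g (k + N) x ∂μ) / (k + N : ℕ) := by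
      filter_upwards [h2.eventually_const_lt hN, eventually_ge_atTop 1] with k hk hk1
      refine hk.trans_le ?_
      have hpos : (0 : ℝ) < k + N := by positivity
      rw [ENNReal.ofReal_div_of_pos hpos, ENNReal.ofReal_natCast,
        show ENNReal.ofReal ((k : ℝ) + N) = ((k + N : ℕ) : ℝ≥0∞) by
          rw [← ENNReal.ofReal_natCast]; push_cast; rfl,
        ENNReal.mul_comm_div, mul_div_assoc']
      gcongr
      exact h1 k
    rw [eventually_atTop] at h3 ⊢
    obtain ⟨K, hK⟩ := h3
    refine ⟨K + N, fun n hn => ?_⟩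
    have := hK (n - N) (by omega)
    rwa [Nat.sub_add_cancel (by omega)] at this
  · filter_upwards [eventually_ge_atTop 1] with n hn
    refine lt_of_le_of_lt ?_ hb
    refine ENNReal.div_le_of_le_mul ?_
    rw [mul_comm]
    exact lintegral_le_mul_growthRate h0 n

theorem ae_exists_ofReal_le_of_lt_growthRate {X : Type*} [MeasurableSpace X] {μ : Measure X}
    [IsProbabilityMeasure μ] {T : X → X} (hT : Ergodic T μ) {g : ℕ → X → ℝ≥0∞}
    (hmeas : ∀ n, Measurable (g n)) (hg : ∀ m n x, g m x + g n (T^[m] x) ≤ g (m + n) x)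
    {a : ℝ} (ha : (a : EReal) < growthRate μ g) {ε : ℝ} (hε : 0 < ε) :
    ∀ᵐ x ∂μ, ∃ D : ℝ, ∀ n m : ℕ,
      ENNReal.ofReal (n * a - (n + m) * ε - D) ≤ g n (T^[m] x) := by
  rcases lt_or_ge a 0 with h | h
  · refine Eventually.of_forall fun x => ⟨0, fun n m => ?_⟩
    rw [ENNReal.ofReal_of_nonpos]
    · exact zero_le
    · have h1 : (n : ℝ) * a ≤ 0 := mul_nonpos_of_nonneg_of_nonpos (by positivity) h.le
      have h2 : 0 ≤ (n + m) * ε := by positivity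
      linarith
  · have ha' : ENNReal.ofReal a < growthRate μ g := by
      rw [← EReal.coe_ennreal_lt_coe_ennreal_iff, EReal.coe_ennreal_ofReal, max_eq_left h]
      exact ha
    obtain ⟨N, hN⟩ := lt_iSup_iff.1 ha'
    refine ae_exists_ofReal_le hT hmeas hg (N := N) ?_ hε
    rw [ENNReal.lt_div_iff_mul_lt (.inl (by positivity)) (.inl (by simp))] at hN
    rw [mul_comm, ENNReal.ofReal_mul h]
    convert hN
    rw [← ENNReal.ofReal_natCast]; push_cast; rfl

/-- Kingman's theorem for a nonnegative superadditive cocycle of finite growth rate, uniformly in the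
starting time. The upper bound at `T^[m] x` follows from
`g n (T^[m] x) ≤ g (m + n) x - g m x` and the bounds at `x` itself. -/
theorem ae_exists_abs_sub_le {X : Type*} [MeasurableSpace X] {μ : Measure X}
    [IsProbabilityMeasure μ] {T : X → X} (hT : Ergodic T μ) {g : ℕ → X → ℝ≥0∞}
    (hmeas : ∀ n, Measurable (g n)) (h0 : g 0 = 0)
    (hg : ∀ m n x, g m x + g n (T^[m] x) ≤ g (m + n) x)
    (hγ : growthRate μ g ≠ ∞) {ε : ℝ} (hε : 0 < ε) :
    ∀ᵐ x ∂μ, ∃ n₀ : ℕ, 1 ≤ n₀ ∧ ∀ n, n₀ ≤ n → ∀ m : ℕ, g n (T^[m] x) ≠ ∞ ∧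
      |(g n (T^[m] x)).toReal - n * (growthRate μ g).toReal| ≤ (n + m) * ε := by
  set γ := (growthRate μ g).toReal with hγr
  have hγ0 : 0 ≤ γ := ENNReal.toReal_nonneg
  have hγe : growthRate μ g = ENNReal.ofReal γ := (ENNReal.ofReal_toReal hγ).symm
  -- up to three errors of slope `ε / 4` arise, and the fourth absorbs the constant `D`
  have hδ : 0 < ε / 4 := by positivity
  have hlow : ((γ - ε / 4 : ℝ) : EReal) < growthRate μ g := by
    rw [hγe, EReal.coe_ennreal_ofReal, max_eq_left hγ0]
    exact_mod_cast (by linarith : γ - ε / 4 < γ)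
  have hup : growthRate μ g < ENNReal.ofReal (γ + ε / 4) := by
    rw [hγe]
    exact (ENNReal.ofReal_lt_ofReal_iff (by positivity)).2 (by linarith)
  filter_upwards [ae_exists_ofReal_le_of_lt_growthRate hT hmeas hg hlow hδ,
    ae_eventually_le_mul hT hmeas hg (by simp) (lintegral_le_mul_growthRate h0) hup] with x h1 h2
  obtain ⟨D, hD⟩ := h1
  obtain ⟨K, hK⟩ := eventually_atTop.1 h2
  obtain ⟨J, hJ⟩ := exists_nat_ge (D / (ε / 4))
  refine ⟨max 1 (max K J), le_max_left _ _, fun n hn m => ?_⟩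
  have hDn : D ≤ n * (ε / 4) := by
    rw [← div_le_iff₀ hδ]
    exact hJ.trans (by exact_mod_cast (le_max_right K J).trans ((le_max_right _ _).trans hn))
  have hu : g m x + g n (T^[m] x) ≤ ENNReal.ofReal ((γ + ε / 4) * (m + n)) := by
    have h3 := (hg m n x).trans
      (hK (m + n) (by have := (le_max_left K J).trans ((le_max_right 1 _).trans hn); omega))
    rw [ENNReal.ofReal_mul (by positivity)]
    refine h3.trans_eq ?_
    congr 1
    rw [← ENNReal.ofReal_natCast]; push_cast; rfl
  have hfin : g m x + g n (T^[m] x) ≠ ∞ := (hu.trans_lt ENNReal.ofReal_lt_top).ne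
  obtain ⟨hm', hn'⟩ := ENNReal.add_ne_top.1 hfin
  refine ⟨hn', ?_⟩
  have hu' := ENNReal.toReal_le_of_le_ofReal (by positivity) hu
  rw [ENNReal.toReal_add hm' hn'] at hu'
  have hl1 := (ENNReal.ofReal_le_iff_le_toReal hn').1 (hD n m)
  have hl2 := (ENNReal.ofReal_le_iff_le_toReal hm').1 (hD m 0)
  have hmε : 0 ≤ m * ε := by positivity
  have hnε : 0 ≤ n * ε := by positivity
  push_cast at hl2
  rw [abs_le]
  constructor <;> linarith

/-! ### Extended logarithms and integrals -/

/-- The amount `n * C - log (f n)` by which `log (f n)` falls short of `n * C`, as an element of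
`[0, ∞]`. It is set to `0` at `n = 0`, where `f 0` is arbitrary, so that the sequence is
superadditive for all indices. -/
noncomputable def logDeficit {X : Type*} (C : ℝ) (f : ℕ → X → ℝ) (n : ℕ) (x : X) : ℝ≥0∞ :=
  if n = 0 then 0 else (((n * C : ℝ) : EReal) - extLog (f n x)).toENNReal

theorem extLog_mono {s t : ℝ} (h : s ≤ t) : extLog s ≤ extLog t :=
  ENNReal.log_monotone (ENNReal.ofReal_le_ofReal h)

theorem extLog_mul {s : ℝ} (t : ℝ) (hs : 0 ≤ s) : extLog (s * t) = extLog s + extLog t := by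
  rw [extLog, ENNReal.ofReal_mul hs, ENNReal.log_mul_add, extLog, extLog]

theorem extLog_exp (c : ℝ) : extLog (Real.exp c) = c := by
  rw [extLog, ENNReal.log_ofReal_of_pos (Real.exp_pos c), Real.log_exp]

theorem coe_sub_toENNReal_coe_sub {u : EReal} {c : ℝ} (hu : u ≤ c) :
    (c : EReal) - ((c - u).toENNReal : EReal) = u := by
  rw [EReal.coe_toENNReal (EReal.sub_nonneg (by simp) (by simp) |>.2 hu)]
  induction u using EReal.rec with
  | bot => simp
  | top => simp at hu
  | coe a => norm_cast; ring

/-- The identity `u⁺ + (c - u) = c + u⁻`, arranged so that no infinite quantity is subtracted. -/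
theorem toENNReal_add_toENNReal_coe_sub {u : EReal} {c : ℝ} (hc : 0 ≤ c) (hu : u ≤ c) :
    u.toENNReal + (c - u).toENNReal = ENNReal.ofReal c + (-u).toENNReal := by
  induction u using EReal.rec with
  | bot => simp
  | top => simp at hu
  | coe a =>
    have ha : a ≤ c := by exact_mod_cast hu
    rw [← EReal.coe_sub, ← EReal.coe_neg]
    simp only [EReal.real_coe_toENNReal]
    rcases le_total 0 a with h | h
    · rw [← ENNReal.ofReal_add h (by linarith), ENNReal.ofReal_of_nonpos (p := -a) (by linarith)]
      simp
    · rw [← ENNReal.ofReal_add hc (by linarith), ENNReal.ofReal_of_nonpos h, zero_add,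
        sub_eq_add_neg]

/-- Subadditivity of `log f` turns into superadditivity of its distance to a linear bound. -/
theorem toENNReal_coe_sub_add_le {u v w : EReal} {a b : ℝ} (hu : u ≤ a) (hv : v ≤ b)
    (hw : w ≤ u + v) :
    ((a : EReal) - u).toENNReal + ((b : EReal) - v).toENNReal
      ≤ (((a + b : ℝ) : EReal) - w).toENNReal := by
  rw [← EReal.toENNReal_add (EReal.sub_nonneg (by simp) (by simp) |>.2 hu)
    (EReal.sub_nonneg (by simp) (by simp) |>.2 hv)]
  refine EReal.toENNReal_le_toENNReal (le_trans ?_ (EReal.sub_le_sub le_rfl hw))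
  induction u using EReal.rec with
  | bot => simp
  | top => simp at hu
  | coe s =>
    induction v using EReal.rec with
    | bot => simp
    | top => simp at hv
    | coe t =>
      norm_cast
      linarith

theorem le_exp_mul {X : Type*} {T : X → X} {f : ℕ → X → ℝ} {C : ℝ}
    (hnonneg : ∀ n, 1 ≤ n → ∀ x, 0 ≤ f n x) (hC : ∀ x, f 1 x ≤ Real.exp C)
    (hsub : ∀ m n, 1 ≤ m → 1 ≤ n → ∀ x, f (n + m) x ≤ f m x * f n (T^[m] x))
    {n : ℕ} (hn : 1 ≤ n) (x : X) : f n x ≤ Real.exp (n * C) := by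
  induction n, hn using Nat.le_induction generalizing x with
  | base => simpa using hC x
  | succ n hn ih =>
    calc f (n + 1) x ≤ f 1 x * f n (T^[1] x) := hsub 1 n le_rfl hn x
      _ ≤ Real.exp C * Real.exp (n * C) :=
        mul_le_mul (hC x) (ih _) (hnonneg n hn _) (Real.exp_pos C).le
      _ = _ := by rw [← Real.exp_add]; push_cast; ring_nf

theorem logDeficit_add_le {X : Type*} {T : X → X} {f : ℕ → X → ℝ} {C : ℝ}
    (hnonneg : ∀ n, 1 ≤ n → ∀ x, 0 ≤ f n x)
    (hlog : ∀ n, 1 ≤ n → ∀ x, extLog (f n x) ≤ ((n * C : ℝ) : EReal))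
    (hsub : ∀ m n, 1 ≤ m → 1 ≤ n → ∀ x, f (n + m) x ≤ f m x * f n (T^[m] x)) (m n : ℕ) (x : X) :
    logDeficit C f m x + logDeficit C f n (T^[m] x) ≤ logDeficit C f (m + n) x := by
  rcases Nat.eq_zero_or_pos m with rfl | hm
  · simp [logDeficit]
  rcases Nat.eq_zero_or_pos n with rfl | hn
  · simp [logDeficit]
  rw [logDeficit, logDeficit, logDeficit, if_neg hm.ne', if_neg hn.ne', if_neg (by omega)]
  have h1 : extLog (f (m + n) x) ≤ extLog (f m x) + extLog (f n (T^[m] x)) := by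
    rw [← extLog_mul _ (hnonneg m hm x), add_comm m n]
    exact extLog_mono (hsub m n hm hn x)
  have h2 := toENNReal_coe_sub_add_le (hlog m hm x) (hlog n hn _) h1
  rwa [← add_mul, ← Nat.cast_add] at h2

theorem extLog_eq_coe_sub_logDeficit {X : Type*} {f : ℕ → X → ℝ} {C : ℝ}
    (hlog : ∀ n, 1 ≤ n → ∀ x, extLog (f n x) ≤ ((n * C : ℝ) : EReal)) {n : ℕ} (hn : 1 ≤ n) (x : X) :
    extLog (f n x) = ((n * C : ℝ) : EReal) - (logDeficit C f n x : EReal) := by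
  rw [logDeficit, if_neg (by omega), coe_sub_toENNReal_coe_sub (hlog n hn x)]

theorem continuous_coe_sub (c : ℝ) : Continuous fun u : EReal => (c : EReal) - u := by
  rw [continuous_iff_continuousAt]
  intro u
  simp only [sub_eq_add_neg]
  exact (EReal.continuousAt_add (p := ((c : EReal), -u)) (.inl (EReal.coe_ne_top c))
    (.inl (EReal.coe_ne_bot c))).comp (f := fun u : EReal => ((c : EReal), -u))
    (continuous_const.prodMk continuous_neg).continuousAt

theorem measurable_extLog : Measurable extLog :=
  ENNReal.measurable_log.comp ENNReal.measurable_ofReal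

theorem measurable_logDeficit {X : Type*} [MeasurableSpace X] {f : ℕ → X → ℝ} (C : ℝ)
    (hmeas : ∀ n, 1 ≤ n → Measurable (f n)) (n : ℕ) : Measurable (logDeficit C f n) := by
  rcases Nat.eq_zero_or_pos n with rfl | hn
  · have : logDeficit C f 0 = fun _ => 0 := by ext x; simp [logDeficit]
    rw [this]
    exact measurable_const
  · have : logDeficit C f n = fun x => (((n * C : ℝ) : EReal) - extLog (f n x)).toENNReal := by
      ext x; simp [logDeficit, hn.ne']
    rw [this]
    exact ((continuous_coe_sub _).measurable.comp
      (measurable_extLog.comp (hmeas n hn))).ereal_toENNReal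

theorem lintegral_toENNReal_lt_top {X : Type*} [MeasurableSpace X] {μ : Measure X}
    [IsFiniteMeasure μ] {u : X → EReal} {c : ℝ} (hu : ∀ x, u x ≤ c) :
    ∫⁻ x, (u x).toENNReal ∂μ < ∞ := by
  have : ∫⁻ x, (u x).toENNReal ∂μ ≤ ∫⁻ _, ENNReal.ofReal c ∂μ :=
    lintegral_mono fun x => EReal.toENNReal_le_toENNReal (hu x)
  refine this.trans_lt ?_
  rw [lintegral_const]
  exact ENNReal.mul_lt_top (by simp) (measure_lt_top _ _)

/-- The extended integral of a function bounded above by `c` is `c` minus the integral of the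
nonnegative function `c - u`. -/
theorem extIntegral_eq_coe_sub {X : Type*} [MeasurableSpace X] {μ : Measure X}
    [IsProbabilityMeasure μ] {u : X → EReal} (hm : Measurable u) {c : ℝ} (hc : 0 ≤ c)
    (hu : ∀ x, u x ≤ c) :
    extIntegral μ u = (c : EReal) - ((∫⁻ x, (c - u x).toENNReal ∂μ : ℝ≥0∞) : EReal) := by
  have h1 : ∫⁻ x, (u x).toENNReal ∂μ + ∫⁻ x, (c - u x).toENNReal ∂μ
      = ENNReal.ofReal c + ∫⁻ x, (-u x).toENNReal ∂μ := by
    rw [← lintegral_add_left hm.ereal_toENNReal,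
      lintegral_congr fun x => toENNReal_add_toENNReal_coe_sub hc (hu x),
      lintegral_add_left measurable_const]
    simp
  have h2 := lintegral_toENNReal_lt_top (μ := μ) hu
  rw [extIntegral]
  generalize ∫⁻ x, (u x).toENNReal ∂μ = P at *
  generalize ∫⁻ x, (-u x).toENNReal ∂μ = Q at *
  generalize ∫⁻ x, (c - u x).toENNReal ∂μ = A at *
  lift P to NNReal using h2.ne
  by_cases hQ : Q = ∞
  · have hA : A = ∞ := by
      subst hQ
      simpa using h1
    simp [hQ, hA]
  · have hA : A ≠ ∞ := by
      rintro rfl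
      exact absurd h1.symm (by simp [hQ])
    lift Q to NNReal using hQ
    lift A to NNReal using hA
    have h3 := congrArg ENNReal.toReal h1
    rw [ENNReal.toReal_add (by simp) (by simp), ENNReal.toReal_add (by simp) (by simp),
      ENNReal.toReal_ofReal hc] at h3
    simp only [ENNReal.coe_toReal] at h3
    have h4 : (P : ℝ) - Q = c - A := by linarith
    change ((P : ℝ) : EReal) - ((Q : ℝ) : EReal) = c - ((A : ℝ) : EReal)
    exact_mod_cast h4

theorem one_div_mul_coe_sub {n : ℕ} (hn : 1 ≤ n) (C : ℝ) (a : ℝ≥0∞) :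
    ((1 / (n : ℝ) : ℝ) : EReal) * (((n * C : ℝ) : EReal) - (a : EReal))
      = (C : EReal) - ((a / n : ℝ≥0∞) : EReal) := by
  have hn0 : (0 : ℝ) < n := by exact_mod_cast hn
  by_cases ha : a = ∞
  · have h1 : (∞ : ℝ≥0∞) / n = ∞ := ENNReal.top_div_of_ne_top (by simp)
    rw [ha, h1]
    simp only [EReal.coe_ennreal_top, sub_eq_add_neg, EReal.neg_top, EReal.add_bot]
    exact EReal.coe_mul_bot_of_pos (by positivity)
  · rw [← ENNReal.ofReal_toReal ha, ← ENNReal.ofReal_natCast, ← ENNReal.ofReal_div_of_pos hn0]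
    have ha0 : 0 ≤ a.toReal := ENNReal.toReal_nonneg
    rw [EReal.coe_ennreal_ofReal, EReal.coe_ennreal_ofReal, max_eq_left ha0,
      max_eq_left (by positivity)]
    norm_cast
    field_simp

/-! ### Submultiplicative cocycles -/

theorem proposition2p1 {X : Type*} [MeasurableSpace X] (μ : Measure X) [IsProbabilityMeasure μ]
    (T : X → X) (hT : Ergodic T μ) (f : ℕ → X → ℝ)
    (hmeas : ∀ n, 1 ≤ n → Measurable (f n))
    (hnonneg : ∀ n, 1 ≤ n → ∀ x, 0 ≤ f n x)
    (hbdd : BddAbove (Set.range (f 1)))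
    (hsub : ∀ m n, 1 ≤ m → 1 ≤ n → ∀ x, f (n + m) x ≤ f m x * f n (T^[m] x)) :
    -- the integrals of `log f_n` are well defined, with values in `[-∞, ∞)`
    (∀ n, 1 ≤ n → ∫⁻ x, (extLog (f n x)).toENNReal ∂μ < ∞) ∧
    ∃ α : EReal, α ≠ ⊤ ∧
      Tendsto (fun n : ℕ => ((1 / (n : ℝ) : ℝ) : EReal) * extIntegral μ (fun x => extLog (f n x)))
        atTop (𝓝 α) ∧
      ∀ ε : ℝ, 0 < ε →
        (α ≠ ⊥ → ∀ᵐ x ∂μ, ∃ n₀ : ℕ, 1 ≤ n₀ ∧ ∀ n, n₀ ≤ n → ∀ m : ℕ,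
          (extLog (f n (T^[m] x)) - ((n : ℝ) : EReal) * α).abs
            ≤ ENNReal.ofReal (((n : ℝ) + (m : ℝ)) * ε)) ∧
        (α = ⊥ → ∀ N : ℝ, 0 < N → ∀ᵐ x ∂μ, ∃ n₀ : ℕ, 1 ≤ n₀ ∧ ∀ n, n₀ ≤ n → ∀ m : ℕ,
          extLog (f n (T^[m] x)) ≤ ((-N * (n : ℝ) + ((n : ℝ) + (m : ℝ)) * ε : ℝ) : EReal)) := by
  obtain ⟨C, hC0, hC⟩ : ∃ C : ℝ, 0 ≤ C ∧ ∀ x, f 1 x ≤ Real.exp C := by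
    obtain ⟨B, hB⟩ := hbdd
    refine ⟨|B|, abs_nonneg B, fun x => ?_⟩
    have h1 : f 1 x ≤ B := hB ⟨x, rfl⟩
    linarith [le_abs_self B, Real.add_one_le_exp |B|]
  have hlog : ∀ n, 1 ≤ n → ∀ x, extLog (f n x) ≤ ((n * C : ℝ) : EReal) := fun n hn x =>
    (extLog_mono (le_exp_mul hnonneg hC hsub hn x)).trans_eq (extLog_exp _)
  set g := logDeficit C f
  have h0 : g 0 = 0 := by ext x; simp [g, logDeficit]
  have hg : ∀ m n x, g m x + g n (T^[m] x) ≤ g (m + n) x := logDeficit_add_le hnonneg hlog hsub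
  have hgm : ∀ n, Measurable (g n) := measurable_logDeficit C hmeas
  have heq : ∀ n, 1 ≤ n → ∀ x, extLog (f n x) = ((n * C : ℝ) : EReal) - (g n x : EReal) :=
    fun n hn x => extLog_eq_coe_sub_logDeficit hlog hn x
  refine ⟨fun n hn => lintegral_toENNReal_lt_top (hlog n hn),
    (C : EReal) - (growthRate μ g : EReal), ?_, ?_, fun ε hε => ⟨fun hα => ?_, fun hα N _ => ?_⟩⟩
  · refine ((EReal.sub_le_sub le_rfl (EReal.coe_ennreal_nonneg _)).trans_lt ?_).ne
    simp
  · refine (((continuous_coe_sub C).comp continuous_coe_ennreal_ereal).tendsto _ |>.comp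
      (tendsto_lintegral_div hT.toMeasurePreserving hgm h0 hg)).congr' ?_
    filter_upwards [eventually_ge_atTop 1] with n hn
    rw [extIntegral_eq_coe_sub (u := fun x => extLog (f n x))
      (measurable_extLog.comp (hmeas n hn)) (by positivity) (hlog n hn),
      one_div_mul_coe_sub hn]
    simp [g, logDeficit, show n ≠ 0 by omega]
  · have hγ : growthRate μ g ≠ ∞ := by
      intro h
      simp [h] at hα
    filter_upwards [ae_exists_abs_sub_le hT hgm h0 hg hγ hε] with x ⟨n₀, hn₀, hx⟩
    refine ⟨n₀, hn₀, fun n hn m => ?_⟩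
    obtain ⟨hfin, habs⟩ := hx n hn m
    rw [heq n (hn₀.trans hn), ← ENNReal.ofReal_toReal hfin, ← ENNReal.ofReal_toReal hγ,
      EReal.coe_ennreal_ofReal, EReal.coe_ennreal_ofReal, max_eq_left ENNReal.toReal_nonneg,
      max_eq_left ENNReal.toReal_nonneg]
    rw [← EReal.coe_sub, ← EReal.coe_sub, ← EReal.coe_mul, ← EReal.coe_sub, EReal.abs_def]
    refine ENNReal.ofReal_le_ofReal ?_
    rw [← abs_neg]
    refine le_trans (le_of_eq ?_) habs
    congr 1
    ring
  · have hγ : growthRate μ g = ∞ := by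
      by_contra h
      rw [← ENNReal.ofReal_toReal h, EReal.coe_ennreal_ofReal, ← EReal.coe_sub] at hα
      exact EReal.coe_ne_bot _ hα
    filter_upwards [ae_exists_ofReal_le_of_lt_growthRate hT hgm hg (a := N + C)
      (by rw [hγ]; exact EReal.coe_lt_top _) (half_pos hε)] with x ⟨D, hD⟩
    obtain ⟨J, hJ⟩ := exists_nat_ge (D / (ε / 2))
    refine ⟨max 1 J, le_max_left _ _, fun n hn m => ?_⟩
    have hDn : D ≤ n * (ε / 2) := by
      rw [← div_le_iff₀ (half_pos hε)]
      exact hJ.trans (by exact_mod_cast (le_max_right 1 J).trans hn)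
    rw [heq n ((le_max_left 1 J).trans hn)]
    have h1 : ((n * (N + C) - (n + m) * (ε / 2) - D : ℝ) : EReal) ≤ (g n (T^[m] x) : EReal) := by
      refine le_trans ?_ (EReal.coe_ennreal_le_coe_ennreal_iff.2 (hD n m))
      rw [EReal.coe_ennreal_ofReal]
      exact_mod_cast le_max_left _ _
    refine (EReal.sub_le_sub le_rfl h1).trans ?_
    have hmε : 0 ≤ m * ε := by positivity
    rw [← EReal.coe_sub, EReal.coe_le_coe_iff]
    linarith
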